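/- **Conventions.** Let $U(p,b)$ be an additively optimal partial computable machine ($p$ a binary program, $b$ a condition; finite objects are identified with natural numbers by a standard encoding): for every partial computable $V$ there is a constant $c_V$ such that whenever $V(p,b)=a$ there is $q$ with $|q|\le|p|+c_V$ and $U(q,b)=a$. Let $C(a\mid b)=\min\{|p| : U(p,b)=a\}$ and $C(y)=C(y\mid\epsilon)$ be plain Kolmogorov complexity. A total protocol $P$ on inputs of length $n$ is a finite binary tree: at each inner node a fixed party (Alice, holding $x\in\{0,1\}^n$, or Bob, holding $y\in\{0,1\}^n$) sends one bit depending on her or his own input, which selects the next node; at a leaf Alice outputs a string depending on the leaf and on $x$. The number of bits exchanged on $(x,y)$ is $CC^P(x,y)$, and $C(P\mid n)$ is the complexity of $P$ (tree, with its functions listed as tables). For $\alpha\in\mathbb N$ let $TCC_I^{\alpha}(x,y)$ be the minimum of $CC^P(x,y)$ over all total protocols $P$ with $C(P\mid n)\le\alpha$ by which Alice outputs $y'$ on every input pair $(x',y')\in\{0,1\}^n\times\{0,1\}^n$ ($\infty$ if there is none). Write $L(n)=\lfloor\log_2(n+2)\rfloor$. **Statement.** There is a constant $c$, depending only on $U$,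 such that the following hold. 1. For all $n,k$ with $c\,L(n)\le k\le n$: (a) there is $y\in\{0,1\}^n$ with $|C(y)-k|\le c$ such that for every $x\in\{0,1\}^n$ and every $\alpha<C(y)-c\,L(n)$ we have $TCC_I^{\alpha}(x,y)\ge n-\alpha-c\,L(n)$; (b) for every $\alpha\in\mathbb N$ there is $y\in\{0,1\}^n$ with $|C(y)-k|\le c$ such that, if $\alpha<C(y)-c\,L(n)$, then $TCC_I^{\alpha}(x,y)\ge n-\alpha$ for every $x\in\{0,1\}^n$. 2. For all $n$, all $x,y\in\{0,1\}^n$ and all $\alpha\ge C(y)+c$ we have $TCC_I^{\alpha}(x,y)\le c$. -/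

import Mathlib

namespace IndividualCC

/-! ### Plain Kolmogorov complexity

Finite objects are identified with natural numbers through their standard `Encodable` codes. -/

/-- A machine maps a binary program and (the code of) a condition to (the code of) an output,
whenever it halts. -/
abbrev Machine := List Bool → ℕ →. ℕ

/-- `U` is a reference machine: it is partial computable and additively optimal, i.e. it simulates
every partial computable machine with a constant overhead in program length. -/
def IsOptimal (U : Machine) : Prop :=
  Partrec₂ U ∧ ∀ V : Machine, Partrec₂ V →
    ∃ c : ℕ, ∀ (p : List Bool) (b a : ℕ), a ∈ V p b →
      ∃ q : List Bool, q.length ≤ p.length + c ∧ a ∈ U q b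

/-- The conditional plain complexity `C(a | b)` on codes: the least length of a program from which
`U` computes `a` given `b`. -/
noncomputable def condC (U : Machine) (a b : ℕ) : ℕ∞ :=
  ⨅ (p : List Bool) (_ : a ∈ U p b), (p.length : ℕ∞)

/-- The plain complexity `C(y)` of a binary string (the condition is the empty string, whose code
is `0`). -/
noncomputable def strC (U : Machine) (y : List Bool) : ℕ∞ :=
  condC U (Encodable.encode y) (Encodable.encode ([] : List Bool))

/-! ### Communication protocols -/

/-- Binary strings of length `n`. -/
abbrev Str (n : ℕ) := List.Vector Bool n

/-- All binary strings of length `n`, in lexicographic order. -/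
def strings : (n : ℕ) → List (Str n)
  | 0 => [List.Vector.nil]
  | n + 1 => (strings n).map (List.Vector.cons false) ++ (strings n).map (List.Vector.cons true)

/-- A (total, deterministic, two-way) protocol on inputs of length `n`: a finite binary tree.  At an
internal node one of the parties sends one bit that depends on the party's own input, and the
conversation continues in the first subtree if the bit is `false`, in the second if it is `true`.
At a leaf Alice outputs a string that depends on her input (and on the leaf). -/
inductive Protocol (n : ℕ) : Type
  | output (g : Str n → List Bool) : Protocol n
  | alice (f : Str n → Bool) (P Q : Protocol n) : Protocol n
  | bob (f : Str n → Bool) (P Q : Protocol n) : Protocol n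

namespace Protocol

variable {n : ℕ}

/-- Alice's output when the protocol is run on `(x, y)`. -/
def result : Protocol n → Str n → Str n → List Bool
  | output g, x, _ => g x
  | alice f P Q, x, y => bif f x then Q.result x y else P.result x y
  | bob f P Q, x, y => bif f y then Q.result x y else P.result x y

/-- The number of bits exchanged when the protocol is run on `(x, y)`. -/
def cost : Protocol n → Str n → Str n → ℕ
  | output _, _, _ => 0
  | alice f P Q, x, y => (bif f x then Q.cost x y else P.cost x y) + 1
  | bob f P Q, x, y => (bif f y then Q.cost x y else P.cost x y) + 1

/-- The protocol computes `f` correctly on all pairs of inputs of length `n`. -/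
def Computes (P : Protocol n) (f : Str n → Str n → List Bool) : Prop :=
  ∀ x y, P.result x y = f x y

/-- The code of a protocol, a finite object: its tree, with the functions at the nodes listed as
tables of values. -/
def code : Protocol n → ℕ
  | output g => Nat.pair 0 (Encodable.encode ((strings n).map g))
  | alice f P Q =>
      Nat.pair 1 (Nat.pair (Encodable.encode ((strings n).map f)) (Nat.pair P.code Q.code))
  | bob f P Q =>
      Nat.pair 2 (Nat.pair (Encodable.encode ((strings n).map f)) (Nat.pair P.code Q.code))

/-- The complexity `C(P | n)` of a protocol. -/
noncomputable def complexity (U : Machine) (P : Protocol n) : ℕ∞ :=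
  condC U P.code n

end Protocol

/-- `TCC_f^α(x, y)`: the least number of bits exchanged on `(x, y)`, over all total protocols of
complexity at most `α` that compute `f` correctly on all inputs (`⊤` if there is none). -/
noncomputable def TCC (U : Machine) {n : ℕ} (f : Str n → Str n → List Bool) (α : ℕ)
    (x y : Str n) : ℕ∞ :=
  ⨅ (P : Protocol n) (_ : P.Computes f ∧ P.complexity U ≤ α), (P.cost x y : ℕ∞)

/-- The identity function `I(x, y) = y`. -/
def identity {n : ℕ} (_ y : Str n) : List Bool := y.toList

/-! ### Sanity checks: optimal machines exist, and the code determines the protocol -/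

theorem exists_isOptimal : ∃ U : Machine, IsOptimal U := by
  refine ⟨fun p b => (Denumerable.ofNat Nat.Partrec.Code (p.takeWhile id).length).eval
    (Nat.pair (Encodable.encode (p.dropWhile id).tail) b), ?_, ?_⟩
  · have h1 : Computable₂ fun (p : List Bool) (_ : ℕ) =>
        Denumerable.ofNat Nat.Partrec.Code (p.takeWhile id).length :=
      ((Primrec.ofNat Nat.Partrec.Code).comp (Primrec.list_length.comp
        ((Primrec.list_takeWhile Primrec.id).comp Primrec.fst))).to_comp
    have h2 : Computable₂ fun (p : List Bool) (b : ℕ) =>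
        Nat.pair (Encodable.encode (p.dropWhile id).tail) b :=
      (Primrec₂.natPair.comp (Primrec.encode.comp (Primrec.list_tail.comp
        ((Primrec.list_dropWhile Primrec.id).comp Primrec.fst))) Primrec.snd).to_comp
    exact Nat.Partrec.Code.eval_part.comp h1 h2
  · intro V hV
    obtain ⟨e, he⟩ := Nat.Partrec.Code.exists_code.1 hV
    refine ⟨Encodable.encode e + 1, fun p b a ha =>
      ⟨List.replicate (Encodable.encode e) true ++ false :: p, ?_, ?_⟩⟩
    · simp; omega
    · have h1 : (List.replicate (Encodable.encode e) true ++ false :: p).takeWhile id =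
          List.replicate (Encodable.encode e) true := by
        generalize Encodable.encode e = m
        induction m with
        | zero => simp
        | succ m ih => simp [List.replicate_succ, ih]
      have h2 : (List.replicate (Encodable.encode e) true ++ false :: p).dropWhile id =
          false :: p := by
        generalize Encodable.encode e = m
        induction m with
        | zero => simp
        | succ m ih => simp [List.replicate_succ, ih]
      change a ∈ Nat.Partrec.Code.eval (Denumerable.ofNat Nat.Partrec.Code
        ((List.replicate (Encodable.encode e) true ++ false :: p).takeWhile id).length)
        (Nat.pair (Encodable.encode
          ((List.replicate (Encodable.encode e) true ++ false :: p).dropWhile id).tail) b)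
      rw [h1, h2, List.length_replicate, Denumerable.ofNat_encode, he]
      have h3 : Encodable.decode (α := List Bool × ℕ)
          (Nat.pair (Encodable.encode p) b) = some (p, b) := by
        rw [← Encodable.encodek (p, b)]; simp
      simp only [List.tail_cons, h3]
      simpa using ha

theorem mem_strings : ∀ {n : ℕ} (x : Str n), x ∈ strings n
  | 0, x => by simp [strings, List.Vector.eq_nil x]
  | n + 1, x => by
    obtain ⟨b, t, rfl⟩ := x.exists_eq_cons
    have := mem_strings t
    rw [strings, List.mem_append, List.mem_map, List.mem_map]
    cases b
    · exact Or.inl ⟨t, this, rfl⟩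
    · exact Or.inr ⟨t, this, rfl⟩

theorem Protocol.code_injective {n : ℕ} :
    Function.Injective (Protocol.code : Protocol n → ℕ) := by
  have key : ∀ {β : Type} [Encodable β] (f g : Str n → β),
      Encodable.encode ((strings n).map f) = Encodable.encode ((strings n).map g) → f = g := by
    intro β _ f g h
    have h' := Encodable.encode_injective h
    rw [List.map_inj_left] at h'
    exact funext fun x => h' x (mem_strings x)
  intro P
  induction P with
  | output g =>
    intro Q h
    cases Q <;> simp only [Protocol.code, Nat.pair_eq_pair] at h
    · rw [key _ _ h.2]
    · omega
    · omega
  | alice f P₁ P₂ ih₁ ih₂ =>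
    intro Q h
    cases Q <;> simp only [Protocol.code, Nat.pair_eq_pair] at h
    · omega
    · rw [key _ _ h.2.1, ih₁ h.2.2.1, ih₂ h.2.2.2]
    · omega
  | bob f P₁ P₂ ih₁ ih₂ =>
    intro Q h
    cases Q <;> simp only [Protocol.code, Nat.pair_eq_pair] at h
    · omega
    · omega
    · rw [key _ _ h.2.1, ih₁ h.2.2.1, ih₂ h.2.2.2]

end IndividualCC

/-! Part 2 is hard-wiring. Bob first says whether his input is `y` and otherwise goes through all
strings (`Protocol.chain`); a program for `y` yields one for this protocol with constant overhead
(`IsOptimal.exists_TCC_identity_le`).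

Part 1 is a counting argument made effective. In a protocol by which Alice learns Bob's input, at
most 2^d inputs of Bob can be finished within d bits (`Protocol.card_cost_le`). Fewer than 2^(α+1)
programs have length at most α, so with d = n-1-α-e they cover at most 2^(n-e) strings. Call a
string low if its complexity is below k-r; there are fewer than 2^(k-r) of these. If the two counts
leave room, some string is neither covered nor low, and the first such string is taken
(`exists_uncovered_string`). It is hard for simple protocols, and not being low is the lower bound
on its complexity.

For the upper bound, simulate `U` in stages and emit, at each stage, every string that is not
covered so far while all its predecessors are covered or low so far (`candidate`). Fewer than
2^(k-r) emitted strings are low. A non-low one is determined by n, lo, hi, e and the number of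
programs of length at most hi that have halted on n (`IsCandidate.eq_of_card_halted_eq`); thanks to
hi + 12 log(n+2) ≤ k these data take at most 2^(k-1) values, over all n together
(`card_goals_mul_two_le`). So at most 2^k strings are ever emitted for a given k, and each has
complexity at most k + O(1), with no information about n needed
(`IsOptimal.exists_condC_le_of_enumeration`).

For (a), all α up to k - 12L are treated at once with e = 3L. For (b), a single α is treated with e
= 0; the plain count then leaves too little room, and the missing room comes from the constant
fraction of programs that output no protocol (`IsOptimal.exists_unproductive`). -/

namespace IndividualCC

/-! ### Lists of binary strings -/

/-- All binary lists of length `n`, in lexicographic order. -/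
def boolLists : ℕ → List (List Bool)
  | 0 => [[]]
  | n + 1 => (boolLists n).map (List.cons false) ++ (boolLists n).map (List.cons true)

/-- All binary lists of length less than `m`. -/
def programs (m : ℕ) : List (List Bool) := (List.range m).flatMap boolLists

theorem length_boolLists (n : ℕ) : (boolLists n).length = 2 ^ n := by
  induction n with
  | zero => rfl
  | succ n ih => simp [boolLists, ih, pow_succ]; ring

theorem mem_boolLists {n : ℕ} {l : List Bool} : l ∈ boolLists n ↔ l.length = n := by
  induction n generalizing l with
  | zero => simp [boolLists]
  | succ n ih =>
    rcases l with _ | ⟨b, l⟩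
    · simp [boolLists]
    · cases b <;> simp [boolLists, ih]

theorem nodup_boolLists (n : ℕ) : (boolLists n).Nodup := by
  induction n with
  | zero => simp [boolLists]
  | succ n ih =>
    refine List.Nodup.append (ih.map (List.cons_injective)) (ih.map (List.cons_injective)) ?_
    intro l h₁ h₂
    obtain ⟨a, -, rfl⟩ := List.mem_map.1 h₁
    obtain ⟨b, -, h⟩ := List.mem_map.1 h₂
    simp at h

theorem map_toList_strings (n : ℕ) :
    (strings n).map List.Vector.toList = boolLists n := by
  induction n with
  | zero => rfl
  | succ n ih =>
    simp only [strings, boolLists, List.map_append, List.map_map, ← ih]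
    rfl

theorem length_strings (n : ℕ) : (strings n).length = 2 ^ n := by
  rw [← length_boolLists, ← map_toList_strings, List.length_map]

theorem mem_programs {m : ℕ} {p : List Bool} : p ∈ programs m ↔ p.length < m := by
  simp [programs, mem_boolLists]

theorem length_programs (m : ℕ) : (programs m).length + 1 = 2 ^ m := by
  induction m with
  | zero => rfl
  | succ m ih =>
    simp only [programs, List.range_succ, List.flatMap_append, List.length_append] at ih ⊢
    simp only [List.flatMap_cons, List.flatMap_nil, List.append_nil, length_boolLists]
    rw [pow_succ]; omega

theorem card_programs_lt (m : ℕ) : (programs m).toFinset.card < 2 ^ m := by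
  have h := length_programs m
  have := List.toFinset_card_le (programs m)
  omega

theorem primrec_boolLists : Primrec boolLists := by
  have hcons (b : Bool) : Primrec fun L : List (List Bool) => L.map (List.cons b) :=
    Primrec.list_map Primrec.id (Primrec.list_cons.comp (Primrec.const b) Primrec.snd).to₂
  refine (Primrec.nat_rec₁ (f := fun _ L =>
    L.map (List.cons false) ++ L.map (List.cons true)) [[]] ?_).of_eq fun n => ?_
  · exact (Primrec.list_append.comp ((hcons false).comp Primrec.snd)
      ((hcons true).comp Primrec.snd)).to₂
  · induction n with
    | zero => rfl
    | succ n ih => simp only [boolLists, ← ih]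

theorem primrec_programs : Primrec programs :=
  Primrec.list_flatMap Primrec.list_range (primrec_boolLists.comp Primrec.snd).to₂

/-- The `j`-th binary list of length `n`. -/
def nthList (n j : ℕ) : List Bool := (boolLists n).getD j []

theorem primrec_nthList : Primrec₂ nthList :=
  (Primrec.list_getD []).comp (primrec_boolLists.comp Primrec.fst) Primrec.snd

theorem nthList_inj {n i j : ℕ} (hi : i < 2 ^ n) (hj : j < 2 ^ n)
    (h : nthList n i = nthList n j) : i = j := by
  rw [← length_boolLists] at hi hj
  rw [nthList, nthList, List.getD_eq_getElem _ _ hi, List.getD_eq_getElem _ _ hj] at h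
  exact (nodup_boolLists n).getElem_inj_iff.1 h

theorem nthList_eq_toList {n j : ℕ} (hj : j < (strings n).length) :
    nthList n j = ((strings n)[j]).toList := by
  have hj' : j < (boolLists n).length := by rwa [length_boolLists, ← length_strings]
  rw [nthList, List.getD_eq_getElem _ _ hj']
  simp only [← map_toList_strings, List.getElem_map]

/-! ### Elementary properties of complexity -/

theorem condC_le_iff {U : Machine} {a b m : ℕ} :
    condC U a b ≤ m ↔ ∃ p : List Bool, p.length ≤ m ∧ a ∈ U p b := by
  constructor
  · intro h
    by_contra! hc
    have : ((m + 1 : ℕ) : ℕ∞) ≤ condC U a b := by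
      refine le_iInf₂ fun p hp => ?_
      have := mt (hc p) (not_not.2 hp)
      exact_mod_cast Nat.succ_le_of_lt (not_le.1 this)
    have := this.trans h
    norm_cast at this
    omega
  · rintro ⟨p, hp, ha⟩
    exact (iInf₂_le p ha).trans (by exact_mod_cast hp)

theorem IsOptimal.exists_condC_le {U : Machine} (hU : IsOptimal U) {V : Machine}
    (hV : Partrec₂ V) :
    ∃ c : ℕ, ∀ (p : List Bool) (b a : ℕ), a ∈ V p b → condC U a b ≤ (p.length + c : ℕ) := by
  obtain ⟨c, hc⟩ := hU.2 V hV
  refine ⟨c, fun p b a ha => condC_le_iff.2 ?_⟩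
  obtain ⟨q, hq, hqa⟩ := hc p b a ha
  exact ⟨q, hq, hqa⟩

/-! ### Complexity of the elements of small enumerable sets -/

/-- Append `a` to `l` unless it is there already. -/
def appendNew (l : List ℕ) (a : ℕ) : List ℕ := if a ∈ l then l else l ++ [a]

/-- The values of `E` at arguments less than `s`, without repetitions, in the order of their
appearance. -/
def history (E : ℕ → Option ℕ) : ℕ → List ℕ
  | 0 => []
  | s + 1 => (E s).elim (history E s) (appendNew (history E s))

theorem primrec_appendNew : Primrec₂ appendNew := by
  have hmem : PrimrecRel fun (L : List ℕ) (a : ℕ) => ∃ x ∈ L, x = a :=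
    PrimrecRel.exists_mem_list Primrec.eq
  have : PrimrecPred fun q : List ℕ × ℕ => q.2 ∈ q.1 :=
    PrimrecPred.of_eq hmem (by simp)
  exact Primrec.ite this Primrec.fst (Primrec.list_concat.comp Primrec.fst Primrec.snd)

theorem primrec_history {E : ℕ → ℕ → Option ℕ} (hE : Primrec₂ E) :
    Primrec₂ fun k s => history (E k) s := by
  refine (Primrec.nat_rec (α := ℕ) (β := List ℕ) (f := fun _ => [])
    (g := fun k q => (E k q.1).elim q.2 (appendNew q.2)) (Primrec.const _) ?_).of_eq fun k s => ?_
  · have h : Primrec₂ fun (q : ℕ × ℕ × List ℕ) (a : ℕ) => appendNew q.2.2 a :=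
      primrec_appendNew.comp (Primrec.snd.comp (Primrec.snd.comp Primrec.fst)) Primrec.snd
    refine (Primrec.option_casesOn (hE.comp Primrec.fst (Primrec.fst.comp Primrec.snd))
      (Primrec.snd.comp Primrec.snd) h).of_eq fun q => ?_
    change _ = (E q.1 q.2.1).elim q.2.2 (appendNew q.2.2)
    cases E q.1 q.2.1 <;> rfl
  · induction s with
    | zero => rfl
    | succ s ih => simp only [history, ← ih]

theorem prefix_appendNew (l : List ℕ) (a : ℕ) : l <+: appendNew l a := by
  unfold appendNew; split_ifs
  · exact List.prefix_refl l
  · exact List.prefix_append l [a]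

theorem mem_appendNew {l : List ℕ} {a b : ℕ} : b ∈ appendNew l a ↔ b ∈ l ∨ b = a := by
  unfold appendNew; split_ifs <;> simp +contextual [*]

theorem nodup_appendNew {l : List ℕ} (h : l.Nodup) (a : ℕ) : (appendNew l a).Nodup := by
  unfold appendNew; split_ifs with ha
  · exact h
  · exact h.append (List.nodup_singleton a) (by simpa using ha)

theorem history_prefix_succ (E : ℕ → Option ℕ) (s : ℕ) : history E s <+: history E (s + 1) := by
  rw [history]
  cases E s
  · exact List.prefix_refl _
  · exact prefix_appendNew _ _

theorem history_prefix (E : ℕ → Option ℕ) {s t : ℕ} (h : s ≤ t) : history E s <+: history E t := by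
  induction t, h using Nat.le_induction with
  | base => exact List.prefix_refl _
  | succ t _ ih => exact ih.trans (history_prefix_succ E t)

theorem nodup_history (E : ℕ → Option ℕ) (s : ℕ) : (history E s).Nodup := by
  induction s with
  | zero => exact List.nodup_nil
  | succ s ih =>
    rw [history]
    cases E s
    · exact ih
    · exact nodup_appendNew ih _

theorem exists_of_mem_history {E : ℕ → Option ℕ} {s a : ℕ} (h : a ∈ history E s) :
    ∃ t, E t = some a := by
  induction s with
  | zero => simp [history] at h
  | succ s ih =>
    rw [history] at h
    cases hE : E s with
    | none => rw [hE] at h; exact ih h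
    | some b =>
      rw [hE] at h
      rcases mem_appendNew.1 h with h | rfl
      · exact ih h
      · exact ⟨s, hE⟩

/-- If at most `2 ^ k` values are enumerated uniformly in `k`, each of them has complexity at most
`k + O(1)`: a list of `k` bits determines both `k` and the position in the enumeration. -/
theorem IsOptimal.exists_condC_le_of_enumeration {U : Machine} (hU : IsOptimal U)
    {σ : Type} [Primcodable σ] {E : ℕ → σ → Option ℕ} (hE : Primrec₂ E)
    (hcard : ∀ (k : ℕ) (F : Finset ℕ), (∀ a ∈ F, ∃ s, E k s = some a) → F.card ≤ 2 ^ k) :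
    ∃ c : ℕ, ∀ (k : ℕ) (s : σ) (a b : ℕ), E k s = some a → condC U a b ≤ (k + c : ℕ) := by
  let E' : ℕ → ℕ → Option ℕ := fun k s => (Encodable.decode (α := σ) s).bind (E k)
  have hE' : Primrec₂ E' :=
    Primrec.option_bind (Primrec.decode.comp Primrec.snd)
      (hE.comp (Primrec.fst.comp Primrec.fst) Primrec.snd).to₂
  have hEE' : ∀ k t a, E' k t = some a → ∃ s, E k s = some a := by
    intro k t a h
    obtain ⟨s, -, hs⟩ := Option.bind_eq_some_iff.1 h
    exact ⟨s, hs⟩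
  let V : Machine := fun p _ => Nat.rfindOpt fun s =>
    (history (E' p.length) s)[@List.idxOf _ instBEqOfDecidableEq p (boolLists p.length)]?
  have hV : Partrec₂ V := by
    refine Partrec.rfindOpt (Primrec.to_comp ?_)
    have hp : Primrec fun q : (List Bool × ℕ) × ℕ => q.1.1 := Primrec.fst.comp Primrec.fst
    have hl := Primrec.list_length.comp hp
    exact Primrec.list_getElem?.comp ((primrec_history hE').comp hl Primrec.snd)
      (Primrec.list_idxOf.comp hp (primrec_boolLists.comp hl))
  obtain ⟨c, hc⟩ := hU.exists_condC_le hV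
  refine ⟨c, fun k s a b hs => ?_⟩
  have ha : a ∈ history (E' k) (Encodable.encode s + 1) := by
    have : E' k (Encodable.encode s) = some a := by simp [E', hs]
    rw [history, this]
    exact mem_appendNew.2 (Or.inr rfl)
  obtain ⟨i, hi, rfl⟩ := List.getElem_of_mem ha
  have hlen : (history (E' k) (Encodable.encode s + 1)).length ≤ 2 ^ k := by
    rw [← List.toFinset_card_of_nodup (nodup_history _ _)]
    refine hcard k _ fun a ha => ?_
    obtain ⟨t, ht⟩ := exists_of_mem_history (List.mem_toFinset.1 ha)
    exact hEE' k t a ht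
  have hi' : i < (boolLists k).length := by rw [length_boolLists]; omega
  have hpl : ((boolLists k)[i]).length = k := mem_boolLists.1 (List.getElem_mem hi')
  have := hc ((boolLists k)[i]) b (history (E' k) (Encodable.encode s + 1))[i] ?_
  · rwa [hpl] at this
  · simp only [V, hpl]
    rw [@List.Nodup.idxOf_getElem _ instBEqOfDecidableEq _ _ (nodup_boolLists k) i hi',
      Nat.rfindOpt_mono]
    · exact ⟨_, List.getElem?_eq_getElem hi⟩
    · intro a m n hmn h
      obtain ⟨r, hr⟩ := history_prefix (E' k) hmn
      have hlt := (List.getElem?_eq_some_iff.1 h).1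
      rw [← hr, List.getElem?_append_left hlt]
      exact h

end IndividualCC

namespace IndividualCC

/-! ### A protocol that favours one string -/

namespace Protocol

variable {n : ℕ}

/-- Bob compares his input with the strings of a list one by one, until he finds it. -/
def chain : List (Str n) → Protocol n
  | [] => output fun _ => []
  | z :: l => bob (fun y => decide (y = z)) (chain l) (output fun _ => z.toList)

theorem result_chain {l : List (Str n)} {y : Str n} (h : y ∈ l) (x : Str n) :
    (chain l).result x y = y.toList := by
  induction l with
  | nil => simp at h
  | cons z l ih =>
    by_cases hz : y = z
    · simp [chain, result, hz]
    · simpa [chain, result, hz] using ih (List.mem_of_ne_of_mem hz h)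

theorem cost_chain_cons (l : List (Str n)) (x y : Str n) : (chain (y :: l)).cost x y = 1 := by
  simp [chain, cost]

end Protocol

/-- The code of `Protocol.chain`, computed from the list of all strings. -/
def chainCode (T l : List (List Bool)) : ℕ :=
  l.foldr (fun z a => Nat.pair 2 (Nat.pair (Encodable.encode (T.map fun w => decide (w = z)))
    (Nat.pair a (Nat.pair 0 (Encodable.encode (T.map fun _ => z))))))
    (Nat.pair 0 (Encodable.encode (T.map fun _ => ([] : List Bool))))

/-- A machine cannot work with the dependent type `Protocol n`; this identity replaces the tree by a
primitive recursive function of plain lists. -/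
theorem Protocol.code_chain {n : ℕ} (l : List (Str n)) :
    (Protocol.chain l).code = chainCode (boolLists n) (l.map List.Vector.toList) := by
  have hc : ∀ z : List Bool, (strings n).map (fun _ => z) = (boolLists n).map fun _ => z := by
    intro z; rw [← map_toList_strings, List.map_map]; rfl
  induction l with
  | nil => simp only [chain, code, chainCode, List.map_nil, List.foldr_nil, hc]
  | cons z l ih =>
    have ht : (strings n).map (fun y => decide (y = z)) =
        (boolLists n).map fun w => decide (w = z.toList) := by
      rw [← map_toList_strings, List.map_map]
      exact List.map_congr_left fun y _ => decide_eq_decide.2 Subtype.ext_iff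
    simp only [chain, code, ih, hc, ht, chainCode, List.map_cons, List.foldr_cons]

theorem primrec_chainCode : Primrec₂ chainCode := by
  have hT : Primrec fun q : (List (List Bool) × List (List Bool)) × (List Bool × ℕ) => q.1.1 :=
    Primrec.fst.comp Primrec.fst
  have hz : Primrec fun q : (List (List Bool) × List (List Bool)) × (List Bool × ℕ) => q.2.1 :=
    Primrec.fst.comp Primrec.snd
  have ha : Primrec fun q : (List (List Bool) × List (List Bool)) × (List Bool × ℕ) => q.2.2 :=
    Primrec.snd.comp Primrec.snd
  have hdec : Primrec fun q : List Bool × List Bool => decide (q.1 = q.2) :=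
    PrimrecPred.decide (Primrec.eq.comp Primrec.fst Primrec.snd)
  refine Primrec.list_foldr (β := List Bool) (σ := ℕ)
    (h := fun (q : List (List Bool) × List (List Bool)) (r : List Bool × ℕ) =>
      Nat.pair 2 (Nat.pair (Encodable.encode (q.1.map fun w => decide (w = r.1)))
      (Nat.pair r.2 (Nat.pair 0 (Encodable.encode (q.1.map fun _ => r.1)))))) Primrec.snd ?_ ?_
  · exact Primrec₂.natPair.comp (Primrec.const 0) (Primrec.encode.comp
      (Primrec.list_map Primrec.fst (Primrec.const []).to₂))
  · refine Primrec₂.natPair.comp (Primrec.const 2) (Primrec₂.natPair.comp (Primrec.encode.comp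
      (Primrec.list_map hT ?_)) (Primrec₂.natPair.comp ha (Primrec₂.natPair.comp (Primrec.const 0)
      (Primrec.encode.comp (Primrec.list_map hT ?_)))))
    · exact (hdec.comp (Primrec.snd.pair (hz.comp Primrec.fst))).to₂
    · exact (hz.comp Primrec.fst).to₂

/-- A string can be hard-wired into a protocol, which then spends one bit on it. -/
theorem IsOptimal.exists_TCC_identity_le {U : Machine} (hU : IsOptimal U) :
    ∃ c : ℕ, ∀ (n : ℕ) (x y : Str n) (α : ℕ), strC U y.toList + c ≤ α →
      TCC U identity α x y ≤ 1 := by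
  -- The favoured string heads the list of all strings, so it costs one bit while every other input
  -- is still found. The default `[]` is irrelevant for programs that output a string.
  let V : Machine := fun p n => (U p 0).bind fun a => Part.some (chainCode (boolLists n)
    ((Encodable.decode (α := List Bool) a).getD [] :: boolLists n))
  have hV : Partrec₂ V := by
    refine Partrec.bind (hU.1.comp Computable.fst (Computable.const 0)) ?_
    have hb : Primrec fun q : (List Bool × ℕ) × ℕ => boolLists q.1.2 :=
      primrec_boolLists.comp (Primrec.snd.comp Primrec.fst)
    exact (primrec_chainCode.comp hb (Primrec.list_cons.comp (Primrec.option_getD.comp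
      (Primrec.decode.comp Primrec.snd) (Primrec.const [])) hb)).to_comp.partrec
  obtain ⟨c, hc⟩ := hU.exists_condC_le hV
  refine ⟨c, fun n x y α h => ?_⟩
  have hfin : strC U y.toList ≠ ⊤ := by
    intro htop; rw [htop, top_add] at h; exact absurd h (by simp)
  obtain ⟨m, hm⟩ := ENat.ne_top_iff_exists.1 hfin
  obtain ⟨p, hp, hpy⟩ := condC_le_iff.1 hm.ge
  rw [← hm] at h
  have hmα : m + c ≤ α := by exact_mod_cast h
  have hcode : (Protocol.chain (y :: strings n)).code ∈ V p n := by
    refine Part.mem_bind_iff.2 ⟨_, hpy, ?_⟩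
    rw [Protocol.code_chain, Encodable.encodek, List.map_cons, map_toList_strings]
    exact Part.mem_some _
  refine (iInf₂_le (Protocol.chain (y :: strings n)) ⟨?_, ?_⟩).trans ?_
  rotate_left
  · intro x' y'
    exact Protocol.result_chain (List.mem_cons_of_mem _ (mem_strings y')) x'
  · refine (hc p n _ hcode).trans ?_
    exact_mod_cast (by omega : p.length + c ≤ α)
  · rw [Protocol.cost_chain_cons]; rfl

end IndividualCC

namespace IndividualCC

/-! ### Closure properties of primitive recursive predicates -/

section

variable {γ β : Type} [Primcodable γ] [Primcodable β]

theorem primrecPred_bex_mem {f : γ → List β} {R : γ → β → Prop} (hf : Primrec f)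
    (hR : PrimrecPred fun q : β × γ => R q.2 q.1) : PrimrecPred fun c => ∃ x ∈ f c, R c x :=
  (PrimrecRel.exists_mem_list (R := fun x c => R c x) hR).comp hf Primrec.id

theorem primrecPred_bex_lt {f : γ → ℕ} {R : γ → ℕ → Prop} (hf : Primrec f)
    (hR : PrimrecPred fun q : ℕ × γ => R q.2 q.1) : PrimrecPred fun c => ∃ x < f c, R c x :=
  (primrecPred_bex_mem (Primrec.list_range.comp hf) hR).of_eq fun c => by simp

theorem primrecPred_ball_lt {f : γ → ℕ} {R : γ → ℕ → Prop} (hf : Primrec f)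
    (hR : PrimrecPred fun q : ℕ × γ => R q.2 q.1) : PrimrecPred fun c => ∀ x < f c, R c x :=
  ((PrimrecRel.forall_mem_list (R := fun x c => R c x) hR).comp (Primrec.list_range.comp hf)
    Primrec.id).of_eq fun c => by simp

theorem primrec_two_pow : Primrec fun n : ℕ => 2 ^ n := by
  refine (Primrec.nat_rec₁ (f := fun _ a => 2 * a) 1
    (Primrec.nat_mul.comp (Primrec.const 2) Primrec.snd).to₂).of_eq fun n => ?_
  induction n with
  | zero => rfl
  | succ n ih => simp only [pow_succ, ih]; ring

end

/-! ### Running a protocol from its code -/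

/-- The code of the protocol that remains after one round of the protocol with code `m`, when
Alice holds the `i`-th string and Bob holds the `j`-th string.  Leaves, and numbers that do not code
a protocol, are left unchanged. -/
def codeStep (i j m : ℕ) : ℕ :=
  if m.unpair.1 = 1 ∨ m.unpair.1 = 2 then
    bif ((Encodable.decode (α := List Bool) m.unpair.2.unpair.1).getD []).getD
        (if m.unpair.1 = 1 then i else j) false
      then m.unpair.2.unpair.2.unpair.2 else m.unpair.2.unpair.2.unpair.1
  else m

/-- With the `j`-th string on Bob's side and some string of length `n` on Alice's side, the protocol
with code `m` ends after at most `d` rounds. -/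
def Reaches (n d m j : ℕ) : Prop := ∃ i < 2 ^ n, ((codeStep i j)^[d] m).unpair.1 = 0

open Classical in
/-- The indices of the strings with which Bob can finish the protocol with code `m` in at most `d`
rounds. -/
noncomputable def leafSet (n d m : ℕ) : Finset ℕ := (Finset.range (2 ^ n)).filter (Reaches n d m)

theorem primrec_codeStep : Primrec fun q : ℕ × ℕ × ℕ => codeStep q.1 q.2.1 q.2.2 := by
  have hm : Primrec fun q : ℕ × ℕ × ℕ => q.2.2.unpair :=
    Primrec.unpair.comp (Primrec.snd.comp Primrec.snd)
  have h2 := Primrec.unpair.comp (Primrec.snd.comp hm)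
  have h3 := Primrec.unpair.comp (Primrec.snd.comp h2)
  have htag (t : ℕ) : PrimrecPred fun q : ℕ × ℕ × ℕ => q.2.2.unpair.1 = t :=
    Primrec.eq.comp (Primrec.fst.comp hm) (Primrec.const t)
  refine Primrec.ite ((htag 1).or (htag 2)) (Primrec.cond ?_ (Primrec.snd.comp h3)
    (Primrec.fst.comp h3)) (Primrec.snd.comp Primrec.snd)
  exact (Primrec.list_getD false).comp (Primrec.option_getD.comp
    (Primrec.decode.comp (Primrec.fst.comp h2)) (Primrec.const []))
    (Primrec.ite (htag 1) Primrec.fst (Primrec.fst.comp Primrec.snd))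

theorem primrecPred_reaches :
    PrimrecPred fun q : ℕ × ℕ × ℕ × ℕ => Reaches q.1 q.2.1 q.2.2.1 q.2.2.2 := by
  refine primrecPred_bex_lt (primrec_two_pow.comp Primrec.fst) ?_
  have hd : Primrec fun q : ℕ × ℕ × ℕ × ℕ × ℕ => q.2.2.1 :=
    Primrec.fst.comp (Primrec.snd.comp Primrec.snd)
  have hm : Primrec fun q : ℕ × ℕ × ℕ × ℕ × ℕ => q.2.2.2.1 :=
    Primrec.fst.comp (Primrec.snd.comp (Primrec.snd.comp Primrec.snd))
  have hj : Primrec fun q : ℕ × ℕ × ℕ × ℕ × ℕ => q.2.2.2.2 :=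
    Primrec.snd.comp (Primrec.snd.comp (Primrec.snd.comp Primrec.snd))
  have hs : Primrec₂ fun (q : ℕ × ℕ × ℕ × ℕ × ℕ) (m : ℕ) => codeStep q.1 q.2.2.2.2 m :=
    primrec_codeStep.comp ((Primrec.fst.comp Primrec.fst).pair
      ((hj.comp Primrec.fst).pair Primrec.snd))
  exact Primrec.eq.comp (Primrec.fst.comp (Primrec.unpair.comp (Primrec.nat_iterate hd hm hs)))
    (Primrec.const 0)

theorem primrec_card_leafSet :
    Primrec fun q : ℕ × ℕ × ℕ => (leafSet q.1 q.2.1 q.2.2).card := by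
  classical
  have h : PrimrecRel fun (j : ℕ) (q : ℕ × ℕ × ℕ) => Reaches q.1 q.2.1 q.2.2 j :=
    primrecPred_reaches.comp (((Primrec.fst.comp Primrec.snd)).pair
      ((Primrec.fst.comp (Primrec.snd.comp Primrec.snd)).pair
        ((Primrec.snd.comp (Primrec.snd.comp Primrec.snd)).pair Primrec.fst)))
  refine (Primrec.list_length.comp (h.listFilter.comp (Primrec.list_range.comp
    (primrec_two_pow.comp Primrec.fst)) Primrec.id)).of_eq fun q => ?_
  rfl

theorem iterate_codeStep_of_fixed {i j m : ℕ} (h : codeStep i j m = m) (d : ℕ) :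
    (codeStep i j)^[d] m = m := Function.iterate_fixed h d

theorem getD_decode_table {n : ℕ} (f : Str n → Bool) {i : ℕ} (hi : i < (strings n).length) :
    ((Encodable.decode (α := List Bool) (Encodable.encode ((strings n).map f))).getD []).getD i
      false = f (strings n)[i] := by
  rw [Encodable.encodek, Option.getD_some, List.getD_eq_getElem _ _ (by simpa using hi)]
  simp

theorem Protocol.codeStep_alice {n : ℕ} (f : Str n → Bool) (P Q : Protocol n) {i : ℕ} (j : ℕ)
    (hi : i < (strings n).length) :
    codeStep i j (alice f P Q).code = bif f (strings n)[i] then Q.code else P.code := by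
  simp only [codeStep, Protocol.code, Nat.unpair_pair, true_or, if_true, getD_decode_table f hi]

theorem Protocol.codeStep_bob {n : ℕ} (f : Str n → Bool) (P Q : Protocol n) (i : ℕ) {j : ℕ}
    (hj : j < (strings n).length) :
    codeStep i j (bob f P Q).code = bif f (strings n)[j] then Q.code else P.code := by
  simp only [codeStep, Protocol.code, Nat.unpair_pair, or_true, if_true, getD_decode_table f hj,
    OfNat.ofNat_ne_one, if_false]

/-- Leaves carry tag 0 and are fixed by `codeStep`, so the tag after `d` rounds tells whether a leaf
was reached in at most `d` rounds, not in exactly `d`. -/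
theorem Protocol.iterate_codeStep_eq_zero_iff {n : ℕ} (P : Protocol n) {i j : ℕ}
    (hi : i < (strings n).length) (hj : j < (strings n).length) (d : ℕ) :
    ((codeStep i j)^[d] P.code).unpair.1 = 0 ↔ P.cost (strings n)[i] (strings n)[j] ≤ d := by
  induction P generalizing d with
  | output g =>
    rw [iterate_codeStep_of_fixed (by simp [codeStep, Protocol.code])]
    simp [Protocol.code, Protocol.cost]
  | alice f P Q ihP ihQ =>
    cases d with
    | zero => simp [Protocol.code, Protocol.cost]
    | succ d =>
      rw [Function.iterate_succ_apply, codeStep_alice f P Q j hi, Protocol.cost]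
      cases f (strings n)[i]
      · simpa using ihP d
      · simpa using ihQ d
  | bob f P Q ihP ihQ =>
    cases d with
    | zero => simp [Protocol.code, Protocol.cost]
    | succ d =>
      rw [Function.iterate_succ_apply, codeStep_bob f P Q i hj, Protocol.cost]
      cases f (strings n)[j]
      · simpa using ihP d
      · simpa using ihQ d

theorem Protocol.reaches_code {n : ℕ} (P : Protocol n) {d j : ℕ} (hj : j < (strings n).length)
    (x : Str n) (h : P.cost x (strings n)[j] ≤ d) : Reaches n d P.code j := by
  obtain ⟨i, hi, rfl⟩ := List.getElem_of_mem (mem_strings x)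
  exact ⟨i, length_strings n ▸ hi, (P.iterate_codeStep_eq_zero_iff hi hj d).2 h⟩

/-- Tag 3 belongs to no protocol: `codeStep` leaves it alone, so tag 0 never appears. Programs with
such outputs cover nothing. -/
theorem leafSet_pair_three (n d m : ℕ) : leafSet n d (Nat.pair 3 m) = ∅ := by
  classical
  refine Finset.filter_eq_empty_iff.2 fun j _ => ?_
  rintro ⟨i, -, h⟩
  rw [iterate_codeStep_of_fixed (by simp [codeStep])] at h
  simp at h

/-- A leaf of a protocol by which Alice learns Bob's input serves only one input of Bob. -/
theorem Protocol.card_cost_le {n : ℕ} (P : Protocol n) (X Y : Finset (Str n))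
    (h : ∀ x ∈ X, ∀ y ∈ Y, P.result x y = y.toList) (d : ℕ) :
    (Y.filter fun y => ∃ x ∈ X, P.cost x y ≤ d).card ≤ 2 ^ d := by
  induction P generalizing X Y d with
  | output g =>
    refine le_trans (Finset.card_le_one.2 ?_) Nat.one_le_two_pow
    intro a ha b hb
    rw [Finset.mem_filter] at ha hb
    obtain ⟨x, hx, -⟩ := ha.2
    -- A single `x` at the leaf suffices: the output `g x` must equal every string of `Y`.
    exact Subtype.ext ((h x hx a ha.1).symm.trans (h x hx b hb.1))
  | alice f P Q ihP ihQ =>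
    cases d with
    | zero => simp [Protocol.cost]
    | succ d =>
      -- Alice's bit splits `X` and keeps `Y`. An input of Bob may be counted on both sides, which
      -- does no harm to the bound.
      have hP := ihP (X.filter fun x => f x = false) Y (fun x hx y hy => by
        rw [Finset.mem_filter] at hx
        simpa [Protocol.result, hx.2] using h x hx.1 y hy) d
      have hQ := ihQ (X.filter fun x => f x = true) Y (fun x hx y hy => by
        rw [Finset.mem_filter] at hx
        simpa [Protocol.result, hx.2] using h x hx.1 y hy) d
      refine (Finset.card_le_card (fun y hy => ?_)).trans ((Finset.card_union_le _ _).trans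
        ((Nat.add_le_add hP hQ).trans (by rw [pow_succ]; omega)))
      rw [Finset.mem_filter] at hy
      obtain ⟨hy, x, hx, hc⟩ := hy
      rw [Finset.mem_union, Finset.mem_filter, Finset.mem_filter]
      cases hf : f x
      · exact Or.inl ⟨hy, x, by simp [hx, hf], by simpa [Protocol.cost, hf] using hc⟩
      · exact Or.inr ⟨hy, x, by simp [hx, hf], by simpa [Protocol.cost, hf] using hc⟩
  | bob f P Q ihP ihQ =>
    cases d with
    | zero => simp [Protocol.cost]
    | succ d =>
      have hP := ihP X (Y.filter fun y => f y = false) (fun x hx y hy => by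
        rw [Finset.mem_filter] at hy
        simpa [Protocol.result, hy.2] using h x hx y hy.1) d
      have hQ := ihQ X (Y.filter fun y => f y = true) (fun x hx y hy => by
        rw [Finset.mem_filter] at hy
        simpa [Protocol.result, hy.2] using h x hx y hy.1) d
      refine (Finset.card_le_card (fun y hy => ?_)).trans ((Finset.card_union_le _ _).trans
        ((Nat.add_le_add hP hQ).trans (by rw [pow_succ]; omega)))
      rw [Finset.mem_filter] at hy
      obtain ⟨hy, x, hx, hc⟩ := hy
      simp only [Finset.mem_union, Finset.mem_filter]
      cases hf : f y
      · exact Or.inl ⟨⟨hy, rfl⟩, x, hx, by simpa [Protocol.cost, hf] using hc⟩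
      · exact Or.inr ⟨⟨hy, rfl⟩, x, hx, by simpa [Protocol.cost, hf] using hc⟩

/-- This is why `CoversAt` may test only the size of `leafSet`: correct protocols pass this
decidable test, and whatever else passes it is harmless for the count. -/
theorem Protocol.card_leafSet_le {n : ℕ} {P : Protocol n} (hP : P.Computes identity) (d : ℕ) :
    (leafSet n d P.code).card ≤ 2 ^ d := by
  classical
  refine le_trans ?_ (P.card_cost_le Finset.univ Finset.univ (fun x _ y _ => hP x y) d)
  refine Finset.card_le_card_of_surjOn (fun y => (boolLists n).idxOf y.toList) fun j hj => ?_
  rw [Finset.mem_coe, leafSet, Finset.mem_filter, Finset.mem_range, ← length_strings] at hj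
  obtain ⟨hj, i, hi, h⟩ := hj
  rw [← length_strings] at hi
  refine ⟨(strings n)[j], ?_, ?_⟩
  · simp only [Finset.coe_filter, Set.mem_ofPred_eq, Finset.mem_univ, true_and]
    exact ⟨_, (P.iterate_codeStep_eq_zero_iff hi hj d).1 h⟩
  · have hj' : j < (boolLists n).length := by rwa [length_boolLists, ← length_strings]
    have : (strings n)[j].toList = (boolLists n)[j] := by
      simp only [← map_toList_strings, List.getElem_map]
    simp only [this]
    exact (nodup_boolLists n).idxOf_getElem j hj'

end IndividualCC

namespace IndividualCC

open Nat.Partrec (Code)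

/-! ### Bounded simulation of a machine -/

/-- The output of the machine with code `u` on the program `p` and the condition `b`, if it is found
within `T` steps. -/
def stage (u : Code) (T b : ℕ) (p : List Bool) : Option ℕ :=
  Code.evaln T u (Nat.pair (Encodable.encode p) b)

theorem primrec_stage (u : Code) :
    Primrec fun q : ℕ × ℕ × List Bool => stage u q.1 q.2.1 q.2.2 :=
  Code.primrec_evaln.comp ((Primrec.fst.pair (Primrec.const u)).pair (Primrec₂.natPair.comp
    (Primrec.encode.comp (Primrec.snd.comp Primrec.snd)) (Primrec.fst.comp Primrec.snd)))

theorem stage_mono {u : Code} {T T' b a : ℕ} {p : List Bool} (hT : T ≤ T')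
    (h : stage u T b p = some a) : stage u T' b p = some a :=
  Code.evaln_mono hT h

theorem stage_unique {u : Code} {T T' b a a' : ℕ} {p : List Bool} (h : stage u T b p = some a)
    (h' : stage u T' b p = some a') : a = a' := by
  have h₁ := stage_mono (le_max_left T T') h
  have h₂ := stage_mono (le_max_right T T') h'
  exact Option.some_injective _ (h₁.symm.trans h₂)

theorem exists_code_stage {U : Machine} (hU : Partrec₂ U) :
    ∃ u : Code, ∀ p b a, a ∈ U p b ↔ ∃ T, stage u T b p = some a := by
  obtain ⟨u, hu⟩ := Code.exists_code.1 hU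
  refine ⟨u, fun p b a => ?_⟩
  have h : Encodable.decode (α := List Bool × ℕ) (Nat.pair (Encodable.encode p) b) =
      some (p, b) := by
    rw [← Encodable.encodek (p, b)]; simp
  have : a ∈ Code.eval u (Nat.pair (Encodable.encode p) b) ↔ a ∈ U p b := by
    rw [hu]; simp [h]
  rw [← this, Code.evaln_complete]
  rfl

theorem eventually_stage {U : Machine} {u : Code}
    (hu : ∀ p b a, a ∈ U p b ↔ ∃ T, stage u T b p = some a) (m b : ℕ) :
    ∀ᶠ T in Filter.atTop, ∀ p : List Bool, p.length < m → ∀ a ∈ U p b,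
      stage u T b p = some a := by
  have h : ∀ p ∈ (programs m).toFinset, ∀ᶠ T in Filter.atTop, ∀ a ∈ U p b,
      stage u T b p = some a := by
    intro p _
    by_cases hp : ∃ a, a ∈ U p b
    · obtain ⟨a, ha⟩ := hp
      obtain ⟨T, hT⟩ := (hu p b a).1 ha
      filter_upwards [Filter.eventually_ge_atTop T] with T' hT' a' ha'
      rw [Part.mem_unique ha' ha]
      exact stage_mono hT' hT
    · exact Filter.Eventually.of_forall fun T a ha => absurd ⟨a, ha⟩ hp
  filter_upwards [(Filter.eventually_all_finset _).2 h] with T hT p hp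
  exact hT p (List.mem_toFinset.2 (mem_programs.2 hp))

/-! ### Strings covered by simple protocols -/

/-- Some program of length at most `α` yields (according to `ev`) the code of a protocol by which at
most `2 ^ d` inputs of Bob, the `j`-th string among them, can be transmitted with `d` bits. -/
def CoversAt (ev : List Bool → Option ℕ) (n α d j : ℕ) : Prop :=
  ∃ p ∈ programs (α + 1), ∃ m ∈ (ev p).toList, (leafSet n d m).card ≤ 2 ^ d ∧ Reaches n d m j

/-- For some `α` between `lo` and `hi`, some program of length at most `α` yields a protocol that
transmits the `j`-th string with less than `n - α - e` bits. -/
def Covers (ev : List Bool → Option ℕ) (n lo hi e j : ℕ) : Prop :=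
  ∃ α < hi + 1, lo ≤ α ∧ α + e < n ∧ CoversAt ev n α (n - 1 - α - e) j

/-- Within `T` steps, the `j`-th string of length `n` is found to have complexity less than
`k - r`. -/
def Low (u : Code) (r k T n j : ℕ) : Prop :=
  ∃ p ∈ programs (k - r), stage u T 0 p = some (Encodable.encode (nthList n j))

theorem Covers.congr {ev ev' : List Bool → Option ℕ} {n lo hi e j : ℕ}
    (h : ∀ p : List Bool, p.length ≤ hi → ev p = ev' p) (hc : Covers ev n lo hi e j) :
    Covers ev' n lo hi e j := by
  obtain ⟨α, hα, hlo, hn, p, hp, m, hm, hr⟩ := hc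
  refine ⟨α, hα, hlo, hn, p, hp, m, ?_, hr⟩
  rwa [← h p (by have := mem_programs.1 hp; omega)]

theorem primrecPred_coversAt (u : Code) :
    PrimrecPred fun q : ℕ × ℕ × ℕ × ℕ × ℕ =>
      CoversAt (stage u q.1 q.2.1) q.2.1 q.2.2.1 q.2.2.2.1 q.2.2.2.2 := by
  have ss {α β γ : Type} [Primcodable α] [Primcodable β] [Primcodable γ] :
    Primrec fun q : α × β × γ => q.2.2 := Primrec.snd.comp Primrec.snd
  refine primrecPred_bex_mem (primrec_programs.comp (Primrec.succ.comp (Primrec.fst.comp ss))) ?_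
  refine primrecPred_bex_mem (Primrec.optionToList.comp ((primrec_stage u).comp
    ((Primrec.fst.comp Primrec.snd).pair ((Primrec.fst.comp ss).pair Primrec.fst)))) ?_
  have hn : Primrec fun q : ℕ × List Bool × ℕ × ℕ × ℕ × ℕ × ℕ => q.2.2.2.1 :=
    Primrec.fst.comp (Primrec.snd.comp ss)
  have hd : Primrec fun q : ℕ × List Bool × ℕ × ℕ × ℕ × ℕ × ℕ => q.2.2.2.2.2.1 :=
    Primrec.fst.comp (Primrec.snd.comp (ss.comp ss))
  have hj : Primrec fun q : ℕ × List Bool × ℕ × ℕ × ℕ × ℕ × ℕ => q.2.2.2.2.2.2 :=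
    Primrec.snd.comp (Primrec.snd.comp (ss.comp ss))
  exact (Primrec.nat_le.comp (primrec_card_leafSet.comp (hn.pair (hd.pair Primrec.fst)))
    (primrec_two_pow.comp hd)).and
    (primrecPred_reaches.comp (hn.pair (hd.pair (Primrec.fst.pair hj))))

theorem primrecPred_covers (u : Code) :
    PrimrecPred fun q : ℕ × ℕ × ℕ × ℕ × ℕ × ℕ =>
      Covers (stage u q.1 q.2.1) q.2.1 q.2.2.1 q.2.2.2.1 q.2.2.2.2.1 q.2.2.2.2.2 := by
  have ss {α β γ : Type} [Primcodable α] [Primcodable β] [Primcodable γ] :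
    Primrec fun q : α × β × γ => q.2.2 := Primrec.snd.comp Primrec.snd
  refine primrecPred_bex_lt (Primrec.succ.comp (Primrec.fst.comp (Primrec.snd.comp ss))) ?_
  have hT : Primrec fun q : ℕ × ℕ × ℕ × ℕ × ℕ × ℕ × ℕ => q.2.1 := Primrec.fst.comp Primrec.snd
  have hn : Primrec fun q : ℕ × ℕ × ℕ × ℕ × ℕ × ℕ × ℕ => q.2.2.1 := Primrec.fst.comp ss
  have hlo : Primrec fun q : ℕ × ℕ × ℕ × ℕ × ℕ × ℕ × ℕ => q.2.2.2.1 :=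
    Primrec.fst.comp (Primrec.snd.comp ss)
  have he : Primrec fun q : ℕ × ℕ × ℕ × ℕ × ℕ × ℕ × ℕ => q.2.2.2.2.2.1 :=
    Primrec.fst.comp (Primrec.snd.comp (ss.comp ss))
  have hj : Primrec fun q : ℕ × ℕ × ℕ × ℕ × ℕ × ℕ × ℕ => q.2.2.2.2.2.2 :=
    Primrec.snd.comp (Primrec.snd.comp (ss.comp ss))
  have hα : Primrec fun q : ℕ × ℕ × ℕ × ℕ × ℕ × ℕ × ℕ => q.1 := Primrec.fst
  refine (Primrec.nat_le.comp hlo hα).and ((Primrec.nat_lt.comp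
    (Primrec.nat_add.comp hα he) hn).and ((primrecPred_coversAt u).comp (hT.pair (hn.pair
      (hα.pair (Primrec.pair ?_ hj))))))
  exact Primrec.nat_sub.comp (Primrec.nat_sub.comp (Primrec.nat_sub.comp hn (Primrec.const 1)) hα)
    he

theorem primrecPred_low (u : Code) (r : ℕ) :
    PrimrecPred fun q : ℕ × ℕ × ℕ × ℕ => Low u r q.1 q.2.1 q.2.2.1 q.2.2.2 := by
  have ss {α β γ : Type} [Primcodable α] [Primcodable β] [Primcodable γ] :
    Primrec fun q : α × β × γ => q.2.2 := Primrec.snd.comp Primrec.snd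
  refine primrecPred_bex_mem (primrec_programs.comp (Primrec.nat_sub.comp Primrec.fst
    (Primrec.const r))) ?_
  exact Primrec.eq.comp ((primrec_stage u).comp ((Primrec.fst.comp ss).pair
    ((Primrec.const 0).pair Primrec.fst))) (Primrec.option_some.comp (Primrec.encode.comp
      (primrec_nthList.comp (Primrec.fst.comp (Primrec.snd.comp ss))
        (Primrec.snd.comp (Primrec.snd.comp ss)))))

/-! ### Candidates -/

/-- At stage `T`, the `j`-th string of length `n` is the first one that is neither covered nor known
to be low, except that it may itself be low.  The number `l` is a bound for `log₂ (n + 2)`. -/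
def IsCandidate (u : Code) (r k T n lo hi e l j : ℕ) : Prop :=
  j < 2 ^ n ∧ lo ≤ n ∧ e ≤ n ∧ n + 2 < 2 ^ (l + 1) ∧ hi + 12 * l ≤ k ∧ k ≤ n ∧
    ¬ Covers (stage u T n) n lo hi e j ∧
    ∀ i < j, Covers (stage u T n) n lo hi e i ∨ Low u r k T n i

open Classical in
/-- The enumeration of all candidates, given `k`. -/
noncomputable def candidate (u : Code) (r k : ℕ) (s : ℕ × ℕ × ℕ × ℕ × ℕ × ℕ × ℕ) : Option ℕ :=
  if IsCandidate u r k s.1 s.2.1 s.2.2.1 s.2.2.2.1 s.2.2.2.2.1 s.2.2.2.2.2.1 s.2.2.2.2.2.2 then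
    some (Encodable.encode (nthList s.2.1 s.2.2.2.2.2.2)) else none

theorem primrec_candidate (u : Code) (r : ℕ) : Primrec₂ (candidate u r) := by
  classical
  have ss {α β γ : Type} [Primcodable α] [Primcodable β] [Primcodable γ] :
    Primrec fun q : α × β × γ => q.2.2 := Primrec.snd.comp Primrec.snd
  let σ := ℕ × ℕ × ℕ × ℕ × ℕ × ℕ × ℕ × ℕ
  have hk : Primrec fun q : σ => q.1 := Primrec.fst
  have hT : Primrec fun q : σ => q.2.1 := Primrec.fst.comp Primrec.snd
  have hn : Primrec fun q : σ => q.2.2.1 := Primrec.fst.comp ss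
  have hlo : Primrec fun q : σ => q.2.2.2.1 := Primrec.fst.comp (Primrec.snd.comp ss)
  have hhi : Primrec fun q : σ => q.2.2.2.2.1 := Primrec.fst.comp (ss.comp ss)
  have he : Primrec fun q : σ => q.2.2.2.2.2.1 := Primrec.fst.comp (Primrec.snd.comp (ss.comp ss))
  have hl : Primrec fun q : σ => q.2.2.2.2.2.2.1 := Primrec.fst.comp (ss.comp (ss.comp ss))
  have hj : Primrec fun q : σ => q.2.2.2.2.2.2.2 := Primrec.snd.comp (ss.comp (ss.comp ss))
  have hcov : PrimrecPred fun q : ℕ × σ => Covers (stage u q.2.2.1 q.2.2.2.1) q.2.2.2.1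
      q.2.2.2.2.1 q.2.2.2.2.2.1 q.2.2.2.2.2.2.1 q.1 :=
    (primrecPred_covers u).comp ((hT.comp Primrec.snd).pair ((hn.comp Primrec.snd).pair
      ((hlo.comp Primrec.snd).pair ((hhi.comp Primrec.snd).pair
        ((he.comp Primrec.snd).pair Primrec.fst)))))
  have hlow : PrimrecPred fun q : ℕ × σ => Low u r q.2.1 q.2.2.1 q.2.2.2.1 q.1 :=
    (primrecPred_low u r).comp ((hk.comp Primrec.snd).pair ((hT.comp Primrec.snd).pair
      ((hn.comp Primrec.snd).pair Primrec.fst)))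
  have hcand : PrimrecPred fun q : σ => IsCandidate u r q.1 q.2.1 q.2.2.1 q.2.2.2.1 q.2.2.2.2.1
      q.2.2.2.2.2.1 q.2.2.2.2.2.2.1 q.2.2.2.2.2.2.2 :=
    (Primrec.nat_lt.comp hj (primrec_two_pow.comp hn)).and
    ((Primrec.nat_le.comp hlo hn).and ((Primrec.nat_le.comp he hn).and
    ((Primrec.nat_lt.comp (Primrec.nat_add.comp hn (Primrec.const 2))
      (primrec_two_pow.comp (Primrec.succ.comp hl))).and
    ((Primrec.nat_le.comp (Primrec.nat_add.comp hhi
      (Primrec.nat_mul.comp (Primrec.const 12) hl)) hk).and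
    ((Primrec.nat_le.comp hk hn).and
    (((hcov.comp (hj.pair Primrec.id)).not).and
    (primrecPred_ball_lt hj (hcov.or hlow))))))))
  exact Primrec.ite hcand (Primrec.option_some.comp (Primrec.encode.comp
    (primrec_nthList.comp hn hj))) (Primrec.const none)

end IndividualCC

namespace IndividualCC

open Nat.Partrec (Code)

/-! ### The number of candidates -/

theorem card_low_lt {u : Code} {m : ℕ} {F : Finset ℕ}
    (hF : ∀ a ∈ F, ∃ p ∈ programs m, ∃ T, stage u T 0 p = some a) : F.card < 2 ^ m := by
  refine lt_of_le_of_lt ?_ (card_programs_lt m)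
  choose! f hf using hF
  refine Finset.card_le_card_of_injOn f (fun a ha => List.mem_toFinset.2 (hf a ha).1) ?_
  intro a ha b hb hab
  obtain ⟨T, hT⟩ := (hf a ha).2
  obtain ⟨T', hT'⟩ := (hf b hb).2
  rw [← hab] at hT'
  exact stage_unique hT hT'

/-- The programs of length at most `hi` that halt within `T` steps on the condition `n`. -/
def halted (u : Code) (T n hi : ℕ) : Finset (List Bool) :=
  (programs (hi + 1)).toFinset.filter fun p => (stage u T n p).isSome

theorem halted_mono (u : Code) (n hi : ℕ) : Monotone fun T => halted u T n hi := by
  intro T T' hT p hp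
  simp only [halted, Finset.mem_filter, Option.isSome_iff_exists] at hp ⊢
  exact ⟨hp.1, hp.2.imp fun a => stage_mono hT⟩

theorem card_halted_lt (u : Code) (T n hi : ℕ) : (halted u T n hi).card < 2 ^ (hi + 1) :=
  (Finset.card_filter_le _ _).trans_lt (card_programs_lt _)

/-- The sets of halted programs grow with the stage, so equal cardinality forces equal sets, and a
halted program keeps its output. -/
theorem stage_eq_of_card_halted_eq {u : Code} {T T' n hi : ℕ}
    (h : (halted u T n hi).card = (halted u T' n hi).card) {p : List Bool} (hp : p.length ≤ hi) :
    stage u T n p = stage u T' n p := by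
  wlog hT : T ≤ T' generalizing T T'
  · exact (this h.symm (le_of_not_ge hT)).symm
  have heq : halted u T n hi = halted u T' n hi :=
    Finset.eq_of_subset_of_card_le (halted_mono u n hi hT) h.ge
  cases h' : stage u T' n p with
  | none =>
    cases h₁ : stage u T n p with
    | none => rfl
    | some a => rw [stage_mono hT h₁] at h'; exact absurd h' (by simp)
  | some a =>
    have hm : p ∈ halted u T' n hi := by
      simp [halted, mem_programs, h', Nat.lt_succ_of_le hp]
    rw [← heq] at hm
    obtain ⟨b, hb⟩ := Option.isSome_iff_exists.1 (Finset.mem_filter.1 hm).2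
    rw [hb, ← h', stage_mono hT hb]

/-- Both stages see the same covered strings. Of two distinct candidates the smaller would have to
be covered or low at the stage of the larger; it is uncovered, and it is never low. -/
theorem IsCandidate.eq_of_card_halted_eq {u : Code} {r k T T' n lo hi e l l' j j' : ℕ}
    (hj : IsCandidate u r k T n lo hi e l j) (hj' : IsCandidate u r k T' n lo hi e l' j')
    (hlow : ∀ T, ¬ Low u r k T n j) (hlow' : ∀ T, ¬ Low u r k T n j')
    (h : (halted u T n hi).card = (halted u T' n hi).card) : j = j' := by
  have hst : ∀ p : List Bool, p.length ≤ hi → stage u T n p = stage u T' n p :=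
    fun p hp => stage_eq_of_card_halted_eq h hp
  obtain ⟨-, -, -, -, -, -, hc, hb⟩ := hj
  obtain ⟨-, -, -, -, -, -, hc', hb'⟩ := hj'
  rcases lt_trichotomy j j' with hlt | heq | hlt
  · rcases hb' j hlt with h₁ | h₁
    · exact absurd (h₁.congr fun p hp => (hst p hp).symm) hc
    · exact absurd h₁ (hlow _)
  · exact heq
  · rcases hb j' hlt with h₁ | h₁
    · exact absurd (h₁.congr hst) hc'
    · exact absurd h₁ (hlow' _)

/-- The sum telescopes. These weights make the count of candidates summable over all lengths `n`. -/
theorem sum_inv_mul_succ_le (M : ℕ) :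
    ∑ n ∈ Finset.range M, (1 : ℚ) / ((n + 1) * (n + 2)) ≤ 1 := by
  have : ∑ n ∈ Finset.range M, (1 : ℚ) / ((n + 1) * (n + 2)) = 1 - 1 / (M + 1) := by
    induction M with
    | zero => simp
    | succ M ih =>
      rw [Finset.sum_range_succ, ih]
      have h₁ : (M : ℚ) + 1 ≠ 0 := by positivity
      have h₂ : (M : ℚ) + 2 ≠ 0 := by positivity
      push_cast
      field_simp
      ring
  rw [this]
  have : (0 : ℚ) ≤ 1 / (M + 1) := by positivity
  linarith

/-- The possible values of the data `(n, lo, hi, e)` and of the number of halted programs, for given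
`k`. -/
def goals (k : ℕ) : Finset (Σ _ : ℕ, ℕ × ℕ × ℕ × ℕ) :=
  ((Finset.range (2 ^ (k + 1))).filter fun n => 12 * Nat.log 2 (n + 2) ≤ k).sigma fun n =>
    Finset.range (n + 1) ×ˢ Finset.range (n + 1) ×ˢ Finset.range (n + 1) ×ˢ
      Finset.range (2 ^ (k + 1 - 12 * Nat.log 2 (n + 2)))

theorem card_goals_mul_two_le (k : ℕ) : (goals k).card * 2 ≤ 2 ^ k := by
  have hterm : ∀ n, 12 * Nat.log 2 (n + 2) ≤ k →
      (n + 1) * ((n + 1) * ((n + 1) * 2 ^ (k + 1 - 12 * Nat.log 2 (n + 2)))) * 2 *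
        ((n + 1) * (n + 2)) ≤ 2 ^ k := by
    intro n hn
    have hL : 1 ≤ Nat.log 2 (n + 2) := Nat.log_pos (by norm_num) (by omega)
    have hlt : n + 2 < 2 ^ (Nat.log 2 (n + 2) + 1) := Nat.lt_pow_succ_log_self (by norm_num) _
    generalize Nat.log 2 (n + 2) = L at *
    have h₁ : n + 1 ≤ 2 ^ (L + 1) := by omega
    calc _ ≤ 2 ^ (L + 1) * (2 ^ (L + 1) * (2 ^ (L + 1) * 2 ^ (k + 1 - 12 * L))) * 2 *
          (2 ^ (L + 1) * 2 ^ (L + 1)) := by gcongr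
      _ = 2 ^ (5 * (L + 1) + (k + 1 - 12 * L) + 1) := by ring
      -- The exponent is k + 7 - 7L, at most k since L ≥ 1. The factor 12 is chosen to pay for three
      -- parameters and for the weight (n+1)(n+2).
      _ ≤ 2 ^ k := Nat.pow_le_pow_right (by norm_num) (by omega)
  rw [goals, Finset.card_sigma]
  simp only [Finset.card_product, Finset.card_range]
  have hq : ((∑ n ∈ (Finset.range (2 ^ (k + 1))).filter fun n => 12 * Nat.log 2 (n + 2) ≤ k,
      (n + 1) * ((n + 1) * ((n + 1) * 2 ^ (k + 1 - 12 * Nat.log 2 (n + 2)))) : ℕ) : ℚ) * 2 ≤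
      2 ^ k := by
    push_cast
    rw [Finset.sum_mul]
    calc _ ≤ ∑ n ∈ (Finset.range (2 ^ (k + 1))).filter fun n => 12 * Nat.log 2 (n + 2) ≤ k,
          (2 : ℚ) ^ k * (1 / ((n + 1) * (n + 2))) := by
          refine Finset.sum_le_sum fun n hn => ?_
          have := hterm n (Finset.mem_filter.1 hn).2
          rw [mul_one_div, le_div_iff₀ (by positivity)]
          exact_mod_cast this
      _ ≤ ∑ n ∈ Finset.range (2 ^ (k + 1)), (2 : ℚ) ^ k * (1 / ((n + 1) * (n + 2))) :=
          Finset.sum_le_sum_of_subset_of_nonneg (Finset.filter_subset _ _)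
            fun n _ _ => by positivity
      _ ≤ 2 ^ k := by
          rw [← Finset.mul_sum]
          exact mul_le_of_le_one_right (by positivity) (sum_inv_mul_succ_le _)
  exact_mod_cast hq

theorem IsCandidate.mem_goals {u : Code} {r k T n lo hi e l j : ℕ}
    (h : IsCandidate u r k T n lo hi e l j) :
    (⟨n, lo, hi, e, (halted u T n hi).card⟩ : Σ _ : ℕ, ℕ × ℕ × ℕ × ℕ) ∈ goals k := by
  obtain ⟨-, hlo, he, hl, hk, hkn, -, -⟩ := h
  have hL : Nat.log 2 (n + 2) ≤ l := Nat.lt_succ_iff.1 (Nat.log_lt_of_lt_pow (by omega) hl)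
  have hn : n + 2 < 2 ^ (k + 1) := hl.trans_le (Nat.pow_le_pow_right (by norm_num) (by omega))
  have hN := (card_halted_lt u T n hi).trans_le
    (Nat.pow_le_pow_right (n := 2) (j := k + 1 - 12 * Nat.log 2 (n + 2)) (by norm_num) (by omega))
  simp only [goals, Finset.mem_sigma, Finset.mem_filter, Finset.mem_range, Finset.mem_product]
  refine ⟨⟨by omega, by omega⟩, by omega, by omega, by omega, hN⟩

/-- Low candidates are charged to short programs, the others to elements of `goals`; for positive
`k` each kind gets half of the budget. -/
theorem card_candidate_le (u : Code) {r : ℕ} (hr : 1 ≤ r) (k : ℕ) (F : Finset ℕ)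
    (hF : ∀ a ∈ F, ∃ s, candidate u r k s = some a) : F.card ≤ 2 ^ k := by
  classical
  let low : ℕ → Prop := fun a => ∃ p ∈ programs (k - r), ∃ T, stage u T 0 p = some a
  have h₁ : (F.filter low).card < 2 ^ (k - r) :=
    card_low_lt fun a ha => (Finset.mem_filter.1 ha).2
  have h₂ : (F.filter fun a => ¬ low a).card ≤ (goals k).card := by
    have hF' : ∀ a ∈ F, ∃ T n lo hi e l j, IsCandidate u r k T n lo hi e l j ∧
        Encodable.encode (nthList n j) = a := by
      intro a ha
      obtain ⟨⟨T, n, lo, hi, e, l, j⟩, hs⟩ := hF a ha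
      simp only [candidate, Option.ite_none_right_eq_some, Option.some.injEq] at hs
      exact ⟨T, n, lo, hi, e, l, j, hs⟩
    choose! T n lo hi e l j hc ha using hF'
    -- The stage enters only through the number of halted programs, and `l` is dropped.
    refine Finset.card_le_card_of_injOn (fun a => ⟨n a, lo a, hi a, e a,
      (halted u (T a) (n a) (hi a)).card⟩) (fun a h => ?_) ?_
    · exact (hc a (Finset.mem_filter.1 h).1).mem_goals
    · intro a haF b hbF hab
      obtain ⟨haF, hla⟩ := Finset.mem_filter.1 haF
      obtain ⟨hbF, hlb⟩ := Finset.mem_filter.1 hbF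
      simp only [Sigma.mk.injEq, heq_eq_eq, Prod.mk.injEq] at hab
      obtain ⟨hn, hlo, hhi, he, hN⟩ := hab
      have hca := hc a haF
      have hcb := hc b hbF
      rw [← hn, ← hhi] at hN
      rw [← hn, ← hlo, ← hhi, ← he] at hcb
      have := hca.eq_of_card_halted_eq hcb ?_ ?_ hN
      · rw [← ha a haF, ← ha b hbF, this, hn]
      · rintro T ⟨p, hp, h⟩
        exact hla ⟨p, hp, T, by rw [h, ha a haF]⟩
      · rintro T ⟨p, hp, h⟩
        exact hlb ⟨p, hp, T, by rw [h, hn, ha b hbF]⟩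
  have h₃ := card_goals_mul_two_le k
  have h₄ := Finset.card_filter_add_card_filter_not (s := F) low
  rcases Nat.eq_zero_or_pos k with rfl | hk
  · simp only [Nat.zero_sub, pow_zero] at h₁ h₃ ⊢
    omega
  · have h₅ : 2 ^ (k - r) ≤ 2 ^ (k - 1) := Nat.pow_le_pow_right (by norm_num) (by omega)
    have h₆ : 2 ^ k = 2 * 2 ^ (k - 1) := by
      rw [← pow_succ', Nat.sub_add_cancel hk]
    omega

end IndividualCC

namespace IndividualCC

open Nat.Partrec (Code)

/-! ### The number of covered strings -/

-- A union bound over the programs outside `Q`: each contributes at most 2^d strings by the test in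
-- `CoversAt`, and those in `Q` contribute none.
open Classical in
theorem card_coversAt_le (ev : List Bool → Option ℕ) (n α d : ℕ) {Q : Finset (List Bool)}
    (hQ : Q ⊆ (programs (α + 1)).toFinset)
    (hQe : ∀ q ∈ Q, ∀ m, ev q = some m → leafSet n d m = ∅) :
    ((Finset.range (2 ^ n)).filter (CoversAt ev n α d)).card ≤
      ((programs (α + 1)).toFinset.card - Q.card) * 2 ^ d := by
  rw [← Finset.card_sdiff_of_subset hQ]
  let S : List Bool → Finset ℕ := fun p =>
    (ev p).elim ∅ fun m => if (leafSet n d m).card ≤ 2 ^ d then leafSet n d m else ∅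
  refine (Finset.card_le_card (t := ((programs (α + 1)).toFinset \ Q).biUnion S) ?_).trans
    (Finset.card_biUnion_le_card_mul _ _ _ fun p _ => ?_)
  · intro j hj
    obtain ⟨hjn, p, hp, m, hm, hcard, hr⟩ := Finset.mem_filter.1 hj
    rw [Option.mem_toList] at hm
    have hjm : j ∈ leafSet n d m := Finset.mem_filter.2 ⟨hjn, hr⟩
    refine Finset.mem_biUnion.2 ⟨p, Finset.mem_sdiff.2 ⟨List.mem_toFinset.2 hp, fun hpQ => ?_⟩, ?_⟩
    · rw [hQe p hpQ m hm] at hjm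
      exact absurd hjm (Finset.notMem_empty j)
    · simpa [S, hm, hcard] using hjm
  · cases h : ev p with
    | none => simp [S, h]
    | some m =>
      simp only [S, h, Option.elim_some]
      split_ifs with hc
      · exact hc
      · simp

-- For each α, 2^(α+1) programs times 2^(n-1-α-e) strings make 2^(n-e), independently of α; hence
-- only the factor `hi + 1`.
open Classical in
theorem card_covers_le (ev : List Bool → Option ℕ) (n lo hi e : ℕ) :
    ((Finset.range (2 ^ n)).filter (Covers ev n lo hi e)).card ≤ (hi + 1) * 2 ^ (n - e) := by
  let S : ℕ → Finset ℕ := fun α =>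
    if α + e < n then (Finset.range (2 ^ n)).filter (CoversAt ev n α (n - 1 - α - e)) else ∅
  have hS : ∀ α ∈ Finset.range (hi + 1), (S α).card ≤ 2 ^ (n - e) := by
    intro α _
    simp only [S]
    split_ifs with h
    · refine (card_coversAt_le ev n α _ (Finset.empty_subset _) (by simp)).trans ?_
      calc _ ≤ 2 ^ (α + 1) * 2 ^ (n - 1 - α - e) :=
            Nat.mul_le_mul_right _ ((Nat.sub_le _ _).trans (card_programs_lt _).le)
        _ = 2 ^ (n - e) := by rw [← pow_add]; congr 1; omega
    · simp
  refine (Finset.card_le_card (t := (Finset.range (hi + 1)).biUnion S) ?_).trans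
    ((Finset.card_biUnion_le_card_mul _ _ _ hS).trans (by simp))
  intro j hj
  obtain ⟨hjn, α, hα, -, hn, hc⟩ := Finset.mem_filter.1 hj
  refine Finset.mem_biUnion.2 ⟨α, Finset.mem_range.2 hα, ?_⟩
  simp only [S, if_pos hn]
  exact Finset.mem_filter.2 ⟨hjn, hc⟩

/-- A constant fraction of the programs does not yield a protocol. -/
theorem IsOptimal.exists_unproductive {U : Machine} (hU : IsOptimal U) :
    ∃ c : ℕ, ∀ n α : ℕ, ∃ Q ⊆ (programs (α + 1)).toFinset,
      (∀ q ∈ Q, ∃ m, Nat.pair 3 m ∈ U q n) ∧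
      (programs (α + 1)).toFinset.card - Q.card + 2 ^ (α - c) ≤ 2 ^ (α + 1) := by
  -- Including `p` in the output makes the simulating programs of distinct `p` distinct.
  obtain ⟨c, hc⟩ := hU.2 (fun p _ => Part.some (Nat.pair 3 (Encodable.encode p)))
    ((Primrec₂.natPair.comp (Primrec.const 3) (Primrec.encode.comp Primrec.fst)).to_comp.partrec)
  refine ⟨c, fun n α => ?_⟩
  have hP := card_programs_lt (α + 1)
  rcases lt_or_ge α c with hα | hα
  -- Here `α - c` truncates to 0, and the required 2^0 = 1 is the strictness in `card_programs_lt`.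
  · refine ⟨∅, Finset.empty_subset _, by simp, ?_⟩
    rw [Nat.sub_eq_zero_of_le hα.le]
    simpa using hP
  · choose f hf using fun p => hc p n _ (Part.mem_some _)
    have hQ : ((boolLists (α - c)).toFinset.image f) ⊆ (programs (α + 1)).toFinset := by
      intro q hq
      obtain ⟨p, hp, rfl⟩ := Finset.mem_image.1 hq
      have h₁ := mem_boolLists.1 (List.mem_toFinset.1 hp)
      have h₂ := (hf p).1
      exact List.mem_toFinset.2 (mem_programs.2 (by omega))
    have hcard : ((boolLists (α - c)).toFinset.image f).card = 2 ^ (α - c) := by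
      rw [Finset.card_image_of_injective, List.toFinset_card_of_nodup (nodup_boolLists _),
        length_boolLists]
      intro p p' h
      have h₁ := (hf p).2
      rw [h] at h₁
      have := Part.mem_unique h₁ (hf p').2
      rw [Nat.pair_eq_pair] at this
      exact Encodable.encode_injective this.2
    refine ⟨_, hQ, ?_, ?_⟩
    · intro q hq
      obtain ⟨p, -, rfl⟩ := Finset.mem_image.1 hq
      exact ⟨_, (hf p).2⟩
    · have := Finset.card_le_card hQ
      omega

open Classical in
theorem card_low_indices_lt (u : Code) (r k T n : ℕ) :
    ((Finset.range (2 ^ n)).filter (Low u r k T n)).card < 2 ^ (k - r) := by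
  have hinj : Set.InjOn (fun j => Encodable.encode (nthList n j))
      ((Finset.range (2 ^ n)).filter (Low u r k T n)) := by
    intro i hi j hj h
    have hi := Finset.mem_range.1 (Finset.mem_filter.1 hi).1
    have hj := Finset.mem_range.1 (Finset.mem_filter.1 hj).1
    exact nthList_inj hi hj (Encodable.encode_injective h)
  rw [← Finset.card_image_of_injOn hinj]
  refine card_low_lt (u := u) fun a ha => ?_
  obtain ⟨j, hj, rfl⟩ := Finset.mem_image.1 ha
  obtain ⟨p, hp, h⟩ := (Finset.mem_filter.1 hj).2
  exact ⟨p, hp, T, h⟩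

/-! ### Uncovered strings of prescribed complexity -/

open Classical in
theorem exists_uncovered_string {U : Machine} {u : Code}
    (hu : ∀ p b a, a ∈ U p b ↔ ∃ T, stage u T b p = some a) {r c : ℕ}
    (hc : ∀ k s a b, candidate u r k s = some a → condC U a b ≤ (k + c : ℕ))
    {n k lo hi e : ℕ} (hlo : lo ≤ n) (he : e ≤ n) (hhi : hi + 12 * Nat.log 2 (n + 2) ≤ k)
    (hkn : k ≤ n) (hcard : ∀ T, ((Finset.range (2 ^ n)).filter
      (Covers (stage u T n) n lo hi e)).card + 2 ^ (k - r) ≤ 2 ^ n) :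
    ∃ y : Str n, strC U y.toList ≤ k + c ∧ k ≤ strC U y.toList + r ∧
      ∀ (x : Str n) (α : ℕ), lo ≤ α → α ≤ hi →
        n ≤ TCC U identity α x y + α + e := by
  -- At this stage all relevant programs that ever halt have halted, so being uncovered and not low
  -- at `T` is final.
  obtain ⟨T, hT₁, hT₂⟩ :=
    ((eventually_stage hu (hi + 1) n).and (eventually_stage hu (k - r) 0)).exists
  have hex : ∃ j, j < 2 ^ n ∧ ¬ Covers (stage u T n) n lo hi e j ∧ ¬ Low u r k T n j := by
    by_contra! hall
    have hsub : Finset.range (2 ^ n) ⊆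
        (Finset.range (2 ^ n)).filter (Covers (stage u T n) n lo hi e) ∪
        (Finset.range (2 ^ n)).filter (Low u r k T n) := by
      intro j hj
      by_cases h : Covers (stage u T n) n lo hi e j
      · exact Finset.mem_union_left _ (Finset.mem_filter.2 ⟨hj, h⟩)
      · exact Finset.mem_union_right _
          (Finset.mem_filter.2 ⟨hj, hall j (Finset.mem_range.1 hj) h⟩)
    have h₁ := (Finset.card_le_card hsub).trans (Finset.card_union_le _ _)
    rw [Finset.card_range] at h₁
    have h₂ := card_low_indices_lt u r k T n
    have h₃ := hcard T
    omega
  obtain ⟨hjn, hjc, hjl⟩ := Nat.find_spec hex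
  have hmin : ∀ i < Nat.find hex, Covers (stage u T n) n lo hi e i ∨ Low u r k T n i := by
    intro i hi
    have := Nat.find_min hex hi
    by_contra! h
    exact this ⟨hi.trans hjn, h⟩
  generalize Nat.find hex = j at hjn hjc hjl hmin
  have hj : j < (strings n).length := by rwa [length_strings]
  have hy : nthList n j = ((strings n)[j]).toList := nthList_eq_toList hj
  refine ⟨(strings n)[j], ?_, ?_, fun x α hα hα' => ?_⟩
  · have : candidate u r k (T, n, lo, hi, e, Nat.log 2 (n + 2), j) =
        some (Encodable.encode (nthList n j)) :=
      if_pos ⟨hjn, hlo, he, Nat.lt_pow_succ_log_self (by norm_num) _, hhi, hkn, hjc, hmin⟩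
    rw [hy] at this
    exact_mod_cast hc _ _ _ _ this
  · by_contra! hlt
    have hfin : strC U ((strings n)[j]).toList ≠ ⊤ := by
      intro htop; rw [htop, top_add] at hlt; exact absurd hlt (by simp)
    obtain ⟨m, hm⟩ := ENat.ne_top_iff_exists.1 hfin
    rw [← hm] at hlt
    have hmk : m + r < k := by exact_mod_cast hlt
    obtain ⟨p, hp, hpa⟩ := condC_le_iff.1 hm.ge
    refine hjl ⟨p, mem_programs.2 (by omega), ?_⟩
    rw [hy]
    exact hT₂ p (by omega) _ hpa
  -- A cheaper protocol would cost at most n-1-α-e on this input, and its program would make `j`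
  -- covered at stage `T`.
  · have key : ((n - α - e : ℕ) : ℕ∞) ≤ TCC U identity α x (strings n)[j] := by
      refine le_iInf₂ fun P hP => ?_
      by_contra! hlt
      have hlt : P.cost x (strings n)[j] < n - α - e := by exact_mod_cast hlt
      obtain ⟨p, hp, hpa⟩ := condC_le_iff.1 hP.2
      refine hjc ⟨α, by omega, hα, by omega, p, mem_programs.2 (by omega), P.code, ?_,
        P.card_leafSet_le hP.1 _, P.reaches_code hj x (by omega)⟩
      rw [Option.mem_toList]
      exact hT₁ p (by omega) _ hpa
    calc (n : ℕ∞) ≤ ((n - α - e : ℕ) : ℕ∞) + α + e := by exact_mod_cast (by omega)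
      _ ≤ _ := by gcongr

end IndividualCC

/-! ### Choice of the parameters and proof of the theorem -/

open IndividualCC in
theorem mainTheorem3 (U : Machine) (hU : IsOptimal U) :
    ∃ c : ℕ,
      (∀ n k : ℕ, c * Nat.log 2 (n + 2) ≤ k → k ≤ n →
        -- one string for all `α`, up to logarithmic precision
        (∃ y : Str n, strC U y.toList ≤ k + c ∧ k ≤ strC U y.toList + c ∧
          ∀ (x : Str n) (α : ℕ), (α + c * Nat.log 2 (n + 2) : ℕ) < strC U y.toList →
            n ≤ TCC U identity α x y + α + (c * Nat.log 2 (n + 2) : ℕ)) ∧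
        -- for a given `α`, a string with the exact bound
        (∀ α : ℕ, ∃ y : Str n, strC U y.toList ≤ k + c ∧ k ≤ strC U y.toList + c ∧
          ∀ x : Str n, (α + c * Nat.log 2 (n + 2) : ℕ) < strC U y.toList →
            n ≤ TCC U identity α x y + α)) ∧
      (∀ (n : ℕ) (x y : Str n) (α : ℕ), strC U y.toList + c ≤ α →
        TCC U identity α x y ≤ c) := by
  classical
  obtain ⟨u, hu⟩ := exists_code_stage hU.1
  obtain ⟨c₀, hc₀⟩ := hU.exists_unproductive
  obtain ⟨c₁, hc₁⟩ := hU.exists_condC_le_of_enumeration (primrec_candidate u (c₀ + 1))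
    (card_candidate_le u (Nat.le_add_left 1 c₀))
  obtain ⟨c₂, hc₂⟩ := hU.exists_TCC_identity_le
  have hupper : ∀ (a : ℕ∞) (k : ℕ), a ≤ k + c₁ → a ≤ k + (c₀ + c₁ + c₂ + 12 : ℕ) :=
    fun a k h => h.trans (by gcongr; omega)
  have hlower : ∀ (a : ℕ∞) (k : ℕ), k ≤ a + (c₀ + 1 : ℕ) → k ≤ a + (c₀ + c₁ + c₂ + 12 : ℕ) :=
    fun a k h => h.trans (add_le_add_right (by exact_mod_cast (by omega)) a)
  refine ⟨c₀ + c₁ + c₂ + 12, fun n k hck hkn => ?_, fun n x y α h => ?_⟩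
  · have hL : 1 ≤ Nat.log 2 (n + 2) := Nat.log_pos (by norm_num) (by omega)
    have hlt : n + 2 < 2 ^ (Nat.log 2 (n + 2) + 1) := Nat.lt_pow_succ_log_self (by norm_num) _
    -- The summand `c₁` of the constant, multiplied by L ≥ 1, absorbs the excess of the complexity
    -- over `k`, and the summand 12 leaves the room that candidates need.
    have hα : ∀ (α : ℕ) (a : ℕ∞), a ≤ k + c₁ →
        (α + (c₀ + c₁ + c₂ + 12) * Nat.log 2 (n + 2) : ℕ) < a →
        α + 12 * Nat.log 2 (n + 2) ≤ k := by
      intro α a ha h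
      have h' : α + (c₀ + c₁ + c₂ + 12) * Nat.log 2 (n + 2) < k + c₁ := by
        exact_mod_cast h.trans_le ha
      nlinarith [Nat.zero_le (c₀ * Nat.log 2 (n + 2)), Nat.zero_le (c₂ * Nat.log 2 (n + 2)),
        Nat.mul_le_mul_left c₁ hL]
    have h12 : 12 * Nat.log 2 (n + 2) ≤ k :=
      (Nat.mul_le_mul_right _ (Nat.le_add_left 12 _)).trans hck
    have h3 : 3 * Nat.log 2 (n + 2) ≤ (c₀ + c₁ + c₂ + 12) * Nat.log 2 (n + 2) :=
      Nat.mul_le_mul_right _ (by omega)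
    obtain ⟨y, hy₁, hy₂, hy⟩ := exists_uncovered_string hu hc₁ (n := n) (k := k) (lo := 0)
      (hi := k - 12 * Nat.log 2 (n + 2)) (e := 3 * Nat.log 2 (n + 2)) (Nat.zero_le _) (by omega)
      (by omega) hkn (fun T => by
        refine (Nat.add_le_add_right (card_covers_le _ _ _ _ _) _).trans ?_
        generalize Nat.log 2 (n + 2) = L at *
        -- The covered strings number at most 2^(n-2L+1), hence at most half of all, and the
        -- allowance for low strings fits in the other half.
        calc _ ≤ 2 ^ (L + 1) * 2 ^ (n - 3 * L) + 2 ^ (n - 1) := by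
              gcongr
              · omega
              · norm_num
              · omega
          _ = 2 ^ (L + 1 + (n - 3 * L)) + 2 ^ (n - 1) := by rw [← pow_add]
          _ ≤ 2 ^ (n - 1) + 2 ^ (n - 1) := by
              gcongr
              · norm_num
              · omega
          _ = 2 ^ n := by rw [← two_mul, ← pow_succ']; congr 1; omega)
    refine ⟨⟨y, hupper _ _ hy₁, hlower _ _ hy₂, fun x α h => ?_⟩, fun α => ?_⟩
    · refine (hy x α (Nat.zero_le _) (by have := hα α _ hy₁ h; omega)).trans ?_
      gcongr
    · by_cases hαk : α + 12 * Nat.log 2 (n + 2) ≤ k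
      · obtain ⟨z, hz₁, hz₂, hz⟩ := exists_uncovered_string hu hc₁ (n := n) (k := k) (lo := α)
          (hi := α) (e := 0) (by omega) (Nat.zero_le _) hαk hkn (fun T => by
            obtain ⟨Q, hQ, hQU, hQc⟩ := hc₀ n α
            have hsub : ((Finset.range (2 ^ n)).filter (Covers (stage u T n) n α α 0)).card ≤
                ((programs (α + 1)).toFinset.card - Q.card) * 2 ^ (n - 1 - α) := by
              refine le_trans (Finset.card_le_card ?_)
                (card_coversAt_le (stage u T n) n α (n - 1 - α) hQ ?_)
              · intro j hj
                obtain ⟨hjn, β, hβ, hβ', -, h⟩ := Finset.mem_filter.1 hj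
                obtain rfl : β = α := by omega
                exact Finset.mem_filter.2 ⟨hjn, h⟩
              · intro q hq m hm
                obtain ⟨m', hm'⟩ := hQU q hq
                rw [Part.mem_unique ((hu q n m).2 ⟨T, hm⟩) hm']
                exact leafSet_pair_three _ _ _
            -- The unproductive programs leave 2^(α-c₀) * 2^(n-1-α) strings free. This accommodates
            -- 2^(k-r) low ones because k ≤ n and r = c₀ + 1.
            calc _ ≤ ((programs (α + 1)).toFinset.card - Q.card) * 2 ^ (n - 1 - α) +
                    2 ^ (α - c₀) * 2 ^ (n - 1 - α) := by
                  refine Nat.add_le_add hsub ?_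
                  rw [← pow_add]
                  exact Nat.pow_le_pow_right (by norm_num) (by omega)
              _ ≤ 2 ^ (α + 1) * 2 ^ (n - 1 - α) := by
                  rw [← add_mul]; exact Nat.mul_le_mul_right _ hQc
              _ = 2 ^ n := by rw [← pow_add]; congr 1; omega)
        refine ⟨z, hupper _ _ hz₁, hlower _ _ hz₂, fun x _ => ?_⟩
        simpa using hz x α le_rfl le_rfl
      -- For such large α the condition on α fails, so any string of the right complexity serves.
      · exact ⟨y, hupper _ _ hy₁, hlower _ _ hy₂, fun x h => absurd (hα α _ hy₁ h) hαk⟩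
  · refine (hc₂ n x y α (le_trans ?_ h)).trans ?_
    · gcongr; omega
    · exact_mod_cast (by omega : 1 ≤ c₀ + c₁ + c₂ + 12)
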